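/- Let $\varepsilon>0$. There exists $N=N(\varepsilon)$ such that the following holds for all integers $n\ge N$, $p\ge 1$, every real $\sigma>0$ and every $\bm{x}\in\{\pm1\}^n$. Let $W$ be a random symmetric $n\times n$ matrix with $W_{ii}=0$ whose entries $W_{ij}=W_{ji}\sim\mathcal N(0,1)$, $i<j$, are independent, and let $C=\bm{x}\bm{x}^T+\sigma W$. Consider the Burer–Monteiro problem $$\min_{V\in\mathbb R^{n\times p}}\ -\langle C,VV^T\rangle\quad\text{s.t.}\quad \operatorname{diag}(VV^T)=(1,\dots,1)^T,$$ where $\langle X,Y\rangle=\operatorname{tr}(X^TY)$; its feasible set is the product of spheres $(\mathbb S^{p-1})^n$, a Riemannian submanifold of $\mathbb R^{n\times p}$. A feasible $V$ is a second-order critical point if the Riemannian gradient of the objective vanishes at $V$ and its Riemannian Hessian at $V$ is positive semidefinite on the tangent space. If $$\sigma<\frac{p-1}{p+1}\sqrt{\frac{n}{(2+\varepsilon)\log n}},$$ then, with probability at least $1-n^{-\varepsilon/4}-4e^{-n}$, all second-order critical points $V$ are optimal, i.e. $V$ is a global minimizer of the Burer–Monteiro problem and $VV^T=\bm{x}\bm{x}^T$.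 -/

import Mathlib

namespace Z2Sync

noncomputable section

/-- The space of real `n × p` matrices with the Frobenius inner product
`⟨X, Y⟩ = ∑ i k, X (i, k) * Y (i, k) = tr (Xᵀ Y)`. -/
abbrev MatSpace (n p : ℕ) : Type := EuclideanSpace ℝ (Fin n × Fin p)

/-- An element of `MatSpace n p`, seen as a matrix. -/
def toMat {n p : ℕ} (V : MatSpace n p) : Matrix (Fin n) (Fin p) ℝ :=
  Matrix.of fun i k => V (i, k)

/-- The objective `V ↦ -⟨C, V Vᵀ⟩ = -tr (Cᵀ V Vᵀ)` of the Burer-Monteiro problem. -/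
def objective {n : ℕ} (p : ℕ) (C : Matrix (Fin n) (Fin n) ℝ) (V : MatSpace n p) : ℝ :=
  -(C.transpose * (toMat V * (toMat V).transpose)).trace

/-- The feasible set `{V : diag (V Vᵀ) = 1}`, i.e. the product of `n` unit spheres of `ℝ^p`. -/
def feasible (n p : ℕ) : Set (MatSpace n p) :=
  {V | ∀ i, (toMat V * (toMat V).transpose) i i = 1}

/-- The space `{U : diag (U Vᵀ) = 0}`; for feasible `V` it is the tangent space at `V` of the
product of spheres. -/
def tangent {n p : ℕ} (V : MatSpace n p) : Submodule ℝ (MatSpace n p) where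
  carrier := {U | ∀ i, (toMat U * (toMat V).transpose) i i = 0}
  zero_mem' := by
    intro i
    simp [toMat, Matrix.mul_apply]
  add_mem' := by
    intro A B hA hB i
    have h1 := hA i
    have h2 := hB i
    simp only [toMat, Matrix.mul_apply, Matrix.of_apply, Matrix.transpose_apply,
      PiLp.add_apply] at h1 h2 ⊢
    simp only [add_mul, Finset.sum_add_distrib, h1, h2, add_zero]
  smul_mem' := by
    intro c A hA i
    have h1 := hA i
    simp only [toMat, Matrix.mul_apply, Matrix.of_apply, Matrix.transpose_apply,
      PiLp.smul_apply, smul_eq_mul] at h1 ⊢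
    simp only [mul_assoc, ← Finset.mul_sum, h1, mul_zero]

/-- The Riemannian gradient at a feasible `V` of the restriction of `f` to the product of spheres
(with the metric inherited from the ambient space): the orthogonal projection onto the tangent
space of the Euclidean gradient of `f`. The formula makes sense, and is smooth for smooth `f`, at
every `V` without zero rows, so that it extends the gradient field to a neighbourhood of the
product of spheres. -/
def riemGrad {n p : ℕ} (f : MatSpace n p → ℝ) (V : MatSpace n p) : MatSpace n p :=
  (tangent V).starProjection (gradient f V)

/-- The Riemannian Hessian at a feasible `V` of the restriction of `f` to the product of spheres,
applied to a tangent vector `U`: the covariant derivative of the gradient field along `U`. The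
Levi-Civita connection of a submanifold of a Euclidean space is the tangential part of the ambient
derivative of a (any) smooth local extension of the vector field. -/
def riemHess {n p : ℕ} (f : MatSpace n p → ℝ) (V U : MatSpace n p) : MatSpace n p :=
  (tangent V).starProjection (fderiv ℝ (riemGrad f) V U)

/-- `V` is a second-order critical point of the Burer-Monteiro problem with cost matrix `C`: it is
feasible, the Riemannian gradient of the objective vanishes at `V`, and the Riemannian Hessian is
positive semidefinite on the tangent space. -/
structure IsSecondOrderCritical {n p : ℕ} (C : Matrix (Fin n) (Fin n) ℝ) (V : MatSpace n p) :
    Prop where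
  mem_feasible : V ∈ feasible n p
  grad_eq_zero : riemGrad (objective p C) V = 0
  hess_nonneg : ∀ U ∈ tangent V, 0 ≤ inner ℝ (riemHess (objective p C) V U) U

/-- `V` is optimal: it is a global minimizer of the Burer-Monteiro problem with cost matrix `C`. -/
def IsOptimal {n p : ℕ} (C : Matrix (Fin n) (Fin n) ℝ) (V : MatSpace n p) : Prop :=
  V ∈ feasible n p ∧ ∀ V' ∈ feasible n p, objective p C V ≤ objective p C V'

/-- `W` is a symmetric Gaussian noise matrix: `W i j = W j i`, `W i i = 0`, and the entries above
the diagonal are independent standard Gaussian variables. -/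
structure IsGaussianNoise {Ω : Type*} [MeasurableSpace Ω] (μ : MeasureTheory.Measure Ω) {n : ℕ}
    (W : Ω → Matrix (Fin n) (Fin n) ℝ) : Prop where
  symm : ∀ ω i j, W ω i j = W ω j i
  diag : ∀ ω i, W ω i i = 0
  law : ∀ i j, i < j →
    ProbabilityTheory.HasLaw (fun ω => W ω i j) (ProbabilityTheory.gaussianReal 0 1) μ
  indep : ProbabilityTheory.iIndepFun
    (fun (e : {e : Fin n × Fin n // e.1 < e.2}) (ω : Ω) => W ω e.1.1 e.1.2) μ

/-- The cost matrix `C = x xᵀ + σ W` of `ℤ₂`-synchronization. -/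
def costMatrix {n : ℕ} (x : Fin n → ℝ) (σ : ℝ) (W : Matrix (Fin n) (Fin n) ℝ) :
    Matrix (Fin n) (Fin n) ℝ :=
  Matrix.vecMulVec x x + σ • W

end

end Z2Sync

/-! The argument separates a deterministic statement from two Gaussian estimates.

Deterministic part: let `v_i` be the rows of a second-order critical `V`, put `w_i = x_i v_i`, `m =
Vᵀx`, `M = ‖m‖`, `u = m / M`, and suppose `‖W‖ ≤ K` with `σK < cn/8`. Averaging the Hessian
condition over projected basis directions makes the multipliers nonnegative and gives `M ≥ n/2`
(`sq_correlation_ge`). Stationarity reads `l_i w_i = m + noise_i`, and a unit vector that is a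
nonnegative multiple of `αu + e` lies within `2‖e‖/α` of `u` (`sq_mul_sum_sq_sub_le`). A first use
of this improves the bound to `M ≥ n - cn/2`. In a second use the noise is split along `V = xuᵀ + (V
- xuᵀ)`: the first piece is parallel to `u` and is absorbed in `α`, which stays at least `cn/2` by
the row-sum hypothesis; the second is controlled by `‖V - xuᵀ‖` itself. The resulting contraction
forces `V = xuᵀ` (`exists_eq_signal_mul`). Optimality follows by weak duality from
`dual_certificate_nonneg`.

Probabilistic part: a net argument gives `‖W‖ ≤ 20√n`, hence `σ‖W‖ = O(n / √log n) = o(n)`. The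
threshold in `σ` comes from the row sums `x_i (Wx)_i`, which are Gaussian with variance at most `n`,
so that all exceed about `-√(2n log n)` by a union bound. -/

namespace Z2Sync

/-! ### Riemannian gradient and Hessian of the objective in coordinates -/

open scoped Topology

/-- Left multiplication `V ↦ C V` on `MatSpace n p`. -/
noncomputable def leftMul {n : ℕ} (p : ℕ) (C : Matrix (Fin n) (Fin n) ℝ) :
    MatSpace n p →L[ℝ] MatSpace n p :=
  LinearMap.toContinuousLinearMap
    { toFun := fun V => WithLp.toLp 2 fun a => ∑ j, C a.1 j * V (j, a.2)
      map_add' := by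
        intro V V'
        ext a
        simp [mul_add, Finset.sum_add_distrib]
      map_smul' := by
        intro c V
        ext a
        simp [Finset.mul_sum, mul_left_comm] }

lemma leftMul_apply {n p : ℕ} (C : Matrix (Fin n) (Fin n) ℝ) (V : MatSpace n p) (i : Fin n)
    (k : Fin p) : leftMul p C V (i, k) = ∑ j, C i j * V (j, k) := rfl

lemma inner_matSpace {n p : ℕ} (U V : MatSpace n p) :
    inner ℝ U V = ∑ i, ∑ k, U (i, k) * V (i, k) := by
  rw [PiLp.inner_apply, Fintype.sum_prod_type]
  simp [mul_comm]

lemma inner_leftMul_comm {n p : ℕ} {C : Matrix (Fin n) (Fin n) ℝ} (hC : ∀ i j, C i j = C j i)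
    (U V : MatSpace n p) : inner ℝ (leftMul p C U) V = inner ℝ U (leftMul p C V) := by
  simp only [inner_matSpace, leftMul_apply, Finset.sum_mul, Finset.mul_sum]
  rw [Finset.sum_comm]
  conv_rhs => rw [Finset.sum_comm]
  refine Finset.sum_congr rfl fun k _ => ?_
  rw [Finset.sum_comm]
  refine Finset.sum_congr rfl fun i _ => Finset.sum_congr rfl fun j _ => ?_
  rw [hC j i]
  ring

lemma objective_eq_inner {n p : ℕ} (C : Matrix (Fin n) (Fin n) ℝ) (V : MatSpace n p) :
    objective p C V = -inner ℝ V (leftMul p C.transpose V) := by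
  simp only [objective, inner_matSpace, leftMul_apply, Matrix.trace, Matrix.diag_apply,
    Matrix.mul_apply, toMat, Matrix.of_apply, Matrix.transpose_apply, Finset.mul_sum]
  congr 1
  refine Finset.sum_congr rfl fun i _ => ?_
  rw [Finset.sum_comm]
  refine Finset.sum_congr rfl fun j _ => Finset.sum_congr rfl fun k _ => ?_
  ring

lemma gradient_objective {n p : ℕ} {C : Matrix (Fin n) (Fin n) ℝ} (hC : ∀ i j, C i j = C j i)
    (V : MatSpace n p) : gradient (objective p C) V = (-2 : ℝ) • leftMul p C V := by
  have hCt : C.transpose = C := by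
    ext i j
    exact hC j i
  refine HasGradientAt.gradient ?_
  rw [hasGradientAt_iff_hasFDerivAt]
  have h : HasFDerivAt (fun V => -inner ℝ V (leftMul p C V)) _ V :=
    ((hasFDerivAt_id V).inner ℝ (leftMul p C).hasFDerivAt).neg
  have hf : objective p C = fun V => -inner ℝ V (leftMul p C V) := by
    funext V
    rw [objective_eq_inner, hCt]
  rw [hf]
  refine h.congr_fderiv ?_
  ext U
  simp only [neg_apply, ContinuousLinearMap.comp_apply,
    ContinuousLinearMap.prod_apply, fderivInnerCLM_apply, InnerProductSpace.toDual_apply_apply,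
    inner_smul_left, ContinuousLinearMap.id_apply, id_eq]
  rw [← inner_leftMul_comm hC, real_inner_comm (leftMul p C V) U]
  simp
  ring

lemma mem_tangent {n p : ℕ} {U V : MatSpace n p} :
    U ∈ tangent V ↔ ∀ i, ∑ k, U (i, k) * V (i, k) = 0 := Iff.rfl

/-- The coefficients of the normal component of `G` at `V`. -/
noncomputable def normalCoeff {n p : ℕ} (G V : MatSpace n p) (i : Fin n) : ℝ :=
  (∑ k, G (i, k) * V (i, k)) / ∑ k, V (i, k) ^ 2

lemma starProjection_tangent {n p : ℕ} (G V : MatSpace n p) (hV : ∀ i, ∑ k, V (i, k) ^ 2 ≠ 0) :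
    (tangent V).starProjection G =
      WithLp.toLp 2 fun a => G a - normalCoeff G V a.1 * V a := by
  refine Submodule.eq_starProjection_of_mem_of_inner_eq_zero (K := tangent V) ?_ ?_
  · rw [mem_tangent]
    intro i
    simp only [sub_mul, Finset.sum_sub_distrib, mul_assoc, ← Finset.mul_sum, ← pow_two]
    rw [normalCoeff, div_mul_cancel₀ _ (hV i), sub_self]
  · intro U hU
    rw [inner_matSpace]
    refine Finset.sum_eq_zero fun i _ => ?_
    have := mem_tangent.1 hU i
    simp only [PiLp.sub_apply, sub_sub_cancel, mul_assoc, ← Finset.mul_sum]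
    rw [Finset.sum_congr rfl fun k _ => mul_comm (V (i, k)) (U (i, k)), this, mul_zero]

/-- The Hessian differentiates `riemGrad` in the ambient space, so its explicit formula is needed on
a full neighbourhood of `V`. -/
lemma eventually_rows_ne_zero {n p : ℕ} {V : MatSpace n p} (hV : ∀ i, ∑ k, V (i, k) ^ 2 ≠ 0) :
    ∀ᶠ V' in 𝓝 V, ∀ i, ∑ k, (V' : MatSpace n p) (i, k) ^ 2 ≠ 0 := by
  rw [Filter.eventually_all]
  intro i
  have hc : Continuous fun V' : MatSpace n p => ∑ k, V' (i, k) ^ 2 := by fun_prop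
  exact hc.continuousAt.eventually_ne (hV i)

lemma riemGrad_objective {n p : ℕ} {C : Matrix (Fin n) (Fin n) ℝ} (hC : ∀ i j, C i j = C j i)
    {V : MatSpace n p} (hV : ∀ i, ∑ k, V (i, k) ^ 2 ≠ 0) :
    riemGrad (objective p C) V = WithLp.toLp 2 fun a =>
      (-2) * (leftMul p C V a - normalCoeff (leftMul p C V) V a.1 * V a) := by
  rw [riemGrad, gradient_objective hC, map_smul, starProjection_tangent _ _ hV]
  rfl

lemma inner_riemHess_objective {n p : ℕ} {C : Matrix (Fin n) (Fin n) ℝ}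
    (hC : ∀ i j, C i j = C j i) {V U : MatSpace n p} (hV : ∀ i, ∑ k, V (i, k) ^ 2 ≠ 0)
    (hU : U ∈ tangent V) :
    inner ℝ (riemHess (objective p C) V U) U =
      2 * (∑ i, normalCoeff (leftMul p C V) V i * ∑ k, U (i, k) ^ 2)
        - 2 * inner ℝ (leftMul p C U) U := by
  have hd : ∀ i, DifferentiableAt ℝ (fun V => normalCoeff (leftMul p C V) V i) V := by
    intro i
    have h1 : DifferentiableAt ℝ (fun V : MatSpace n p => leftMul p C V) V :=
      (leftMul p C).differentiableAt
    have h2 : DifferentiableAt ℝ (fun V : MatSpace n p => ∑ k, leftMul p C V (i, k) * V (i, k)) V :=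
      DifferentiableAt.fun_sum fun k _ => by fun_prop
    have h3 : DifferentiableAt ℝ (fun V : MatSpace n p => ∑ k, V (i, k) ^ 2) V :=
      DifferentiableAt.fun_sum fun k _ => by fun_prop
    exact h2.fun_mul (h3.fun_inv (hV i))
  have hcoord : ∀ a, HasFDerivAt
      (fun V => (-2) * (leftMul p C V a - normalCoeff (leftMul p C V) V a.1 * V a)) _ V :=
    fun a => HasFDerivAt.const_mul
      (((PiLp.hasFDerivAt_apply (𝕜 := ℝ) 2 (leftMul p C V) a).comp V
        (leftMul p C).hasFDerivAt).sub
      ((hd a.1).hasFDerivAt.mul (PiLp.hasFDerivAt_apply (𝕜 := ℝ) 2 V a))) (-2)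
  have hev := (eventually_rows_ne_zero hV).mono fun V' hV' => riemGrad_objective hC hV'
  have hgrad : DifferentiableAt ℝ (riemGrad (objective p C)) V :=
    (differentiableAt_euclidean.2 fun a => (hcoord a).differentiableAt).congr_of_eventuallyEq hev
  have hval : ∀ a, fderiv ℝ (riemGrad (objective p C)) V U a =
      (-2) * (leftMul p C U a - (normalCoeff (leftMul p C V) V a.1 * U a +
        V a * fderiv ℝ (fun V => normalCoeff (leftMul p C V) V a.1) V U)) := by
    intro a
    have h1 := (PiLp.hasFDerivAt_apply (𝕜 := ℝ) 2 (riemGrad (objective p C) V) a).comp V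
      hgrad.hasFDerivAt
    have h2 := (hcoord a).congr_of_eventuallyEq
      (hev.mono fun V' hV' => congrArg (fun G : MatSpace n p => G a) hV')
    have h3 := DFunLike.congr_fun (h1.unique h2) U
    simpa using! h3
  rw [riemHess, Submodule.inner_starProjection_left_eq_right,
    Submodule.starProjection_eq_self_iff.2 hU, inner_matSpace, inner_matSpace, Finset.mul_sum,
    Finset.mul_sum, ← Finset.sum_sub_distrib]
  refine Finset.sum_congr rfl fun i _ => ?_
  have hUi := mem_tangent.1 hU i
  have hterm : ∀ k, fderiv ℝ (riemGrad (objective p C)) V U (i, k) * U (i, k) =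
      2 * (normalCoeff (leftMul p C V) V i * U (i, k) ^ 2) - 2 * (leftMul p C U (i, k) * U (i, k)) +
        2 * fderiv ℝ (fun V => normalCoeff (leftMul p C V) V i) V U * (U (i, k) * V (i, k)) := by
    intro k
    rw [hval]
    ring
  -- The derivative of the normal coefficient multiplies the row `V i`, to which the row of `U` is
  -- orthogonal; that term vanishes.
  simp only [hterm, Finset.sum_add_distrib, Finset.sum_sub_distrib, ← Finset.mul_sum, hUi]
  ring

/-- The multipliers of the Burer-Monteiro problem at `V`. -/
noncomputable def multiplier {n p : ℕ} (C : Matrix (Fin n) (Fin n) ℝ)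
    (V : Fin n → Fin p → ℝ) (i : Fin n) : ℝ :=
  ∑ k, (∑ j, C i j * V j k) * V i k

lemma IsSecondOrderCritical.euclidean_conditions {n p : ℕ} {C : Matrix (Fin n) (Fin n) ℝ}
    (hC : ∀ i j, C i j = C j i) {V : MatSpace n p} (h : IsSecondOrderCritical C V) :
    (∀ i, ∑ k, toMat V i k ^ 2 = 1) ∧
    (∀ i k, ∑ j, C i j * toMat V j k = multiplier C (toMat V) i * toMat V i k) ∧
    ∀ U : Fin n → Fin p → ℝ, (∀ i, ∑ k, U i k * toMat V i k = 0) →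
      ∑ i, ∑ k, (∑ j, C i j * U j k) * U i k ≤
        ∑ i, multiplier C (toMat V) i * ∑ k, U i k ^ 2 := by
  have h1 : ∀ i, ∑ k, V (i, k) ^ 2 = 1 := by
    intro i
    have := h.mem_feasible i
    simpa [toMat, Matrix.mul_apply, pow_two] using this
  have hV : ∀ i, ∑ k, V (i, k) ^ 2 ≠ 0 := fun i => by
    rw [h1 i]
    exact one_ne_zero
  have hm : ∀ i, normalCoeff (leftMul p C V) V i = multiplier C (toMat V) i := by
    intro i
    rw [normalCoeff, h1, div_one]
    rfl
  refine ⟨h1, fun i k => ?_, fun U hU => ?_⟩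
  · have hg := congrArg (fun G : MatSpace n p => G (i, k))
      ((riemGrad_objective hC hV).symm.trans h.grad_eq_zero)
    simp only [hm, leftMul_apply, PiLp.zero_apply] at hg
    change ∑ j, C i j * V (j, k) = _ * V (i, k)
    linarith
  · have hU' : (WithLp.toLp 2 fun a => U a.1 a.2 : MatSpace n p) ∈ tangent V :=
      mem_tangent.2 hU
    have hh := h.hess_nonneg _ hU'
    rw [inner_riemHess_objective hC hV hU', inner_matSpace] at hh
    simp only [hm, leftMul_apply] at hh
    linarith

end Z2Sync

/-! ### Deterministic analysis of second-order critical points -/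

namespace Z2Sync

section Deterministic

variable {n p : ℕ}

/-- The second-order condition averaged over the tangent vectors whose rows are the projections of
`s i • e`, where `e` runs through the standard basis of `ℝ^p`. -/
lemma averaged_second_order {C : Matrix (Fin n) (Fin n) ℝ} {V : Fin n → Fin p → ℝ}
    {l : Fin n → ℝ} (hV : ∀ i, ∑ k, V i k ^ 2 = 1)
    (hso : ∀ U : Fin n → Fin p → ℝ, (∀ i, ∑ k, U i k * V i k = 0) →
      ∑ i, ∑ k, (∑ j, C i j * U j k) * U i k ≤ ∑ i, l i * ∑ k, U i k ^ 2)
    (s : Fin n → ℝ) :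
    ∑ i, ∑ j, C i j * (s i * s j) * ((p - 2 : ℝ) + (∑ k, V i k * V j k) ^ 2) ≤
      (p - 1 : ℝ) * ∑ i, l i * s i ^ 2 := by
  let U : Fin p → Fin n → Fin p → ℝ := fun q i k => s i * ((if k = q then 1 else 0) - V i q * V i k)
  have hVV : ∀ i, ∑ k, V i k * V i k = 1 := fun i => by simpa only [pow_two] using hV i
  have hU : ∀ q i, ∑ k, U q i k * V i k = 0 := by
    intro q i
    have : ∀ k, U q i k * V i k =
        s i * ((if k = q then V i k else 0) - V i q * (V i k * V i k)) := by
      intro k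
      simp only [U]
      split_ifs <;> ring
    simp only [this, ← Finset.mul_sum, Finset.sum_sub_distrib, hVV]
    simp
  -- This is the trace of the product of the projections `I - v_i v_iᵀ` and `I - v_j v_jᵀ`.
  have hUU : ∀ i j, ∑ q, ∑ k, U q i k * U q j k =
      s i * s j * ((p - 2 : ℝ) + (∑ k, V i k * V j k) ^ 2) := by
    intro i j
    have : ∀ q k, U q i k * U q j k = s i * s j * ((if k = q then (1 : ℝ) else 0) -
        (if k = q then V i k * V i k else 0) - (if k = q then V j k * V j k else 0) +
        (V i q * V j q) * (V i k * V j k)) := by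
      intro q k
      simp only [U]
      split_ifs with h
      · subst h
        ring
      · ring
    simp only [this, ← Finset.mul_sum, Finset.sum_add_distrib, Finset.sum_sub_distrib,
      Finset.sum_ite_eq', Finset.mem_univ, if_true, hVV, ← Finset.sum_mul,
      Finset.sum_const, Finset.card_univ, Fintype.card_fin, nsmul_eq_mul, mul_one]
    ring
  have hsum := Finset.sum_le_sum fun q (_ : q ∈ Finset.univ) => hso (U q) (hU q)
  have hl : ∑ q, ∑ i, ∑ k, (∑ j, C i j * U q j k) * U q i k =
      ∑ i, ∑ j, C i j * (s i * s j) * ((p - 2 : ℝ) + (∑ k, V i k * V j k) ^ 2) := by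
    rw [Finset.sum_comm]
    refine Finset.sum_congr rfl fun i _ => ?_
    have : ∀ j, C i j * (s i * s j) * ((p - 2 : ℝ) + (∑ k, V i k * V j k) ^ 2) =
        ∑ q, ∑ k, C i j * U q j k * U q i k := by
      intro j
      rw [mul_assoc, ← hUU]
      simp only [Finset.mul_sum]
      exact Finset.sum_congr rfl fun _ _ => Finset.sum_congr rfl fun _ _ => by ring
    simp only [this, Finset.sum_mul]
    rw [Finset.sum_comm (γ := Fin n)]
    exact Finset.sum_congr rfl fun q _ => Finset.sum_comm
  have hr : ∑ q, ∑ i, l i * ∑ k, U q i k ^ 2 = (p - 1 : ℝ) * ∑ i, l i * s i ^ 2 := by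
    rw [Finset.sum_comm, Finset.mul_sum]
    refine Finset.sum_congr rfl fun i _ => ?_
    simp only [pow_two]
    rw [← Finset.mul_sum, hUU, hVV]
    ring
  rwa [hl, hr] at hsum

/-- The averaged condition is tested on a single row, where it becomes `(p - 1) C i i ≤ (p - 1) l
i`. -/
lemma multiplier_nonneg_of_second_order {C : Matrix (Fin n) (Fin n) ℝ} {V : Fin n → Fin p → ℝ}
    {l : Fin n → ℝ} (hp : 2 ≤ p) (hC : ∀ i, 0 ≤ C i i) (hV : ∀ i, ∑ k, V i k ^ 2 = 1)
    (hso : ∀ U : Fin n → Fin p → ℝ, (∀ i, ∑ k, U i k * V i k = 0) →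
      ∑ i, ∑ k, (∑ j, C i j * U j k) * U i k ≤ ∑ i, l i * ∑ k, U i k ^ 2) (i : Fin n) :
    0 ≤ l i := by
  have h := averaged_second_order hV hso (Pi.single i 1)
  have hp' : (2 : ℝ) ≤ p := by exact_mod_cast hp
  have hl : ∑ a, ∑ b, C a b * ((Pi.single i 1 : Fin n → ℝ) a * (Pi.single i 1 : Fin n → ℝ) b) *
      ((p - 2 : ℝ) + (∑ k, V a k * V b k) ^ 2) = C i i * (p - 1) := by
    rw [Finset.sum_eq_single i (fun a _ ha => by simp [ha]) (by simp),
      Finset.sum_eq_single i (fun a _ ha => by simp [ha]) (by simp)]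
    simp only [Pi.single_eq_same, ← pow_two, hV]
    ring
  have hr : ∑ a, l a * (Pi.single i 1 : Fin n → ℝ) a ^ 2 = l i := by
    rw [Finset.sum_eq_single i (fun a _ ha => by simp [ha]) (by simp)]
    simp
  rw [hl, hr] at h
  have h2 : 0 ≤ (p - 1 : ℝ) * l i := (mul_nonneg (hC i) (by linarith)).trans h
  exact nonneg_of_mul_nonneg_right h2 (by linarith)

lemma sum_sq_mul_le {κ : Type*} [Fintype κ] {W : Matrix (Fin n) (Fin n) ℝ} {K : ℝ}
    (hK : ∀ b : Fin n → ℝ, ∑ i, (∑ j, W i j * b j) ^ 2 ≤ K ^ 2 * ∑ j, b j ^ 2)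
    (B : Fin n → κ → ℝ) :
    ∑ i, ∑ k, (∑ j, W i j * B j k) ^ 2 ≤ K ^ 2 * ∑ i, ∑ k, B i k ^ 2 := by
  rw [Finset.sum_comm, Finset.sum_comm (f := fun i k => B i k ^ 2), Finset.mul_sum]
  exact Finset.sum_le_sum fun k _ => hK fun j => B j k

lemma abs_quadratic_le {W : Matrix (Fin n) (Fin n) ℝ} {K : ℝ} (hK0 : 0 ≤ K)
    (hK : ∀ b : Fin n → ℝ, ∑ i, (∑ j, W i j * b j) ^ 2 ≤ K ^ 2 * ∑ j, b j ^ 2) (b : Fin n → ℝ) :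
    |∑ i, b i * ∑ j, W i j * b j| ≤ K * ∑ j, b j ^ 2 := by
  have hb : 0 ≤ ∑ j, b j ^ 2 := Finset.sum_nonneg fun _ _ => sq_nonneg _
  refine abs_le_of_sq_le_sq ?_ (mul_nonneg hK0 hb)
  calc _ ≤ (∑ i, b i ^ 2) * ∑ i, (∑ j, W i j * b j) ^ 2 := Finset.sum_mul_sq_le_sq_mul_sq _ _ _
    _ ≤ (∑ i, b i ^ 2) * (K ^ 2 * ∑ j, b j ^ 2) := by gcongr; exact hK b
    _ = _ := by ring

/-- Pairing `W` with a Gram matrix costs `K` times its trace, whatever the dimension of the Gram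
vectors. -/
lemma abs_sum_quadratic_le {κ : Type*} [Fintype κ] {W : Matrix (Fin n) (Fin n) ℝ} {K : ℝ}
    (hK0 : 0 ≤ K)
    (hK : ∀ b : Fin n → ℝ, ∑ i, (∑ j, W i j * b j) ^ 2 ≤ K ^ 2 * ∑ j, b j ^ 2)
    (B : Fin n → κ → ℝ) :
    |∑ i, ∑ j, W i j * ∑ k, B i k * B j k| ≤ K * ∑ i, ∑ k, B i k ^ 2 := by
  have h : ∑ i, ∑ j, W i j * ∑ k, B i k * B j k = ∑ k, ∑ i, B i k * ∑ j, W i j * B j k := by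
    rw [Finset.sum_comm (γ := κ)]
    refine Finset.sum_congr rfl fun i _ => ?_
    simp only [Finset.mul_sum]
    rw [Finset.sum_comm]
    exact Finset.sum_congr rfl fun _ _ => Finset.sum_congr rfl fun _ _ => by ring
  rw [h, Finset.sum_comm (f := fun i k => B i k ^ 2), Finset.mul_sum]
  exact (Finset.abs_sum_le_sum_abs _ _).trans
    (Finset.sum_le_sum fun k _ => abs_quadratic_le hK0 hK fun j => B j k)

/-- `‖VVᵀ‖ = ‖VᵀV‖` in Frobenius norm; keeping the diagonal of the `p × p` matrix `VᵀV`, of trace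
`n`, Cauchy–Schwarz gives the bound. -/
lemma sum_sq_gram_ge {V : Fin n → Fin p → ℝ} (hp : 0 < p) (hV : ∀ i, ∑ k, V i k ^ 2 = 1) :
    (n : ℝ) ^ 2 / p ≤ ∑ i, ∑ j, (∑ k, V i k * V j k) ^ 2 := by
  have h1 : ∑ i, ∑ j, (∑ k, V i k * V j k) ^ 2 = ∑ k, ∑ q, (∑ i, V i k * V i q) ^ 2 := by
    have e1 : ∀ i j, (∑ k, V i k * V j k) ^ 2 =
        ∑ k, ∑ q, (V i k * V i q) * (V j k * V j q) := by
      intro i j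
      rw [pow_two, Finset.sum_mul_sum]
      exact Finset.sum_congr rfl fun _ _ => Finset.sum_congr rfl fun _ _ => by ring
    have e2 : ∀ k q, (∑ i, V i k * V i q) ^ 2 =
        ∑ i, ∑ j, (V i k * V i q) * (V j k * V j q) := by
      intro k q
      rw [pow_two, Finset.sum_mul_sum]
    simp only [e1, e2]
    exact (Finset.sum_congr rfl fun i _ => Finset.sum_comm).trans
      (Finset.sum_comm.trans (Finset.sum_congr rfl fun k _ =>
        (Finset.sum_congr rfl fun i _ => Finset.sum_comm).trans Finset.sum_comm))
  have h2 : ∑ k, ∑ i, V i k ^ 2 = (n : ℝ) := by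
    rw [Finset.sum_comm]
    simp [hV]
  have h3 := sq_sum_le_card_mul_sum_sq (s := Finset.univ) (f := fun k => ∑ i, V i k ^ 2)
  rw [h2, Finset.card_univ, Fintype.card_fin] at h3
  rw [h1, div_le_iff₀' (by exact_mod_cast hp)]
  refine h3.trans ?_
  gcongr with k _
  simp only [pow_two (V _ k)]
  exact Finset.single_le_sum (f := fun q => (∑ i, V i k * V i q) ^ 2)
    (fun _ _ => sq_nonneg _) (Finset.mem_univ k)

lemma costMatrix_apply (x : Fin n → ℝ) (σ : ℝ) (W : Matrix (Fin n) (Fin n) ℝ) (i j : Fin n) :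
    costMatrix x σ W i j = x i * x j + σ * W i j := by
  simp [costMatrix, Matrix.vecMulVec_apply]

/-- At a second-order critical point the rows are correlated with the signal. -/
lemma sq_correlation_ge {x : Fin n → ℝ} {σ K : ℝ} {W : Matrix (Fin n) (Fin n) ℝ}
    {V : Fin n → Fin p → ℝ} (hp : 2 ≤ p) (hσ : 0 ≤ σ) (hx : ∀ i, x i ^ 2 = 1) (hK0 : 0 ≤ K)
    (hK : ∀ b : Fin n → ℝ, ∑ i, (∑ j, W i j * b j) ^ 2 ≤ K ^ 2 * ∑ j, b j ^ 2)
    (hσK : σ * K ≤ n / 8) (hV : ∀ i, ∑ k, V i k ^ 2 = 1)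
    (hso : ∀ U : Fin n → Fin p → ℝ, (∀ i, ∑ k, U i k * V i k = 0) →
      ∑ i, ∑ k, (∑ j, costMatrix x σ W i j * U j k) * U i k ≤
        ∑ i, multiplier (costMatrix x σ W) V i * ∑ k, U i k ^ 2) :
    (n : ℝ) ^ 2 / 4 ≤ ∑ k, (∑ i, x i * V i k) ^ 2 := by
  have hp' : (2 : ℝ) ≤ p := by exact_mod_cast hp
  have h := averaged_second_order hV hso x
  -- The squared inner products form the Gram matrix of the tensors `v_i ⊗ v_i`. With the signs `x
  -- i` these are again unit vectors, so each noise term pairs `W` with a Gram matrix of trace `n`.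
  have hl : ∑ i, ∑ j, costMatrix x σ W i j * (x i * x j) *
      ((p - 2 : ℝ) + (∑ k, V i k * V j k) ^ 2) =
      (p - 2) * n ^ 2 + ∑ i, ∑ j, (∑ k, V i k * V j k) ^ 2 +
        σ * ((p - 2) * ∑ i, ∑ j, W i j * ∑ _k : Fin 1, x i * x j) +
        σ * ∑ i, ∑ j, W i j * ∑ q : Fin p × Fin p,
          (x i * (V i q.1 * V i q.2)) * (x j * (V j q.1 * V j q.2)) := by
    have e : ∀ i j, costMatrix x σ W i j * (x i * x j) *
        ((p - 2 : ℝ) + (∑ k, V i k * V j k) ^ 2) = (p - 2) + (∑ k, V i k * V j k) ^ 2 +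
        σ * ((p - 2) * (W i j * ∑ _k : Fin 1, x i * x j)) +
        σ * (W i j * ∑ q : Fin p × Fin p,
          (x i * (V i q.1 * V i q.2)) * (x j * (V j q.1 * V j q.2))) := by
      intro i j
      have e1 : ∑ q : Fin p × Fin p, (x i * (V i q.1 * V i q.2)) * (x j * (V j q.1 * V j q.2)) =
          x i * x j * (∑ k, V i k * V j k) ^ 2 := by
        rw [pow_two, Finset.sum_mul_sum, Finset.mul_sum, Fintype.sum_prod_type]
        simp only [Finset.mul_sum]
        exact Finset.sum_congr rfl fun _ _ => Finset.sum_congr rfl fun _ _ => by ring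
      rw [e1, costMatrix_apply, Fin.sum_univ_one]
      linear_combination ((p - 2 : ℝ) + (∑ k, V i k * V j k) ^ 2) *
        (x j ^ 2 * hx i + hx j)
    simp only [e, Finset.sum_add_distrib, ← Finset.mul_sum]
    simp
    ring
  have hr : ∑ i, multiplier (costMatrix x σ W) V i * x i ^ 2 =
      ∑ k, (∑ i, x i * V i k) ^ 2 + σ * ∑ i, ∑ j, W i j * ∑ k, V i k * V j k := by
    have e : ∀ i, multiplier (costMatrix x σ W) V i * x i ^ 2 =
        ∑ k, ∑ j, (x i * V i k) * (x j * V j k) + σ * ∑ j, W i j * ∑ k, V i k * V j k := by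
      intro i
      rw [hx, mul_one, multiplier]
      simp only [Finset.mul_sum, Finset.sum_mul]
      rw [Finset.sum_comm (f := fun j k => σ * (W i j * (V i k * V j k))),
        ← Finset.sum_add_distrib]
      refine Finset.sum_congr rfl fun k _ => ?_
      rw [← Finset.sum_add_distrib]
      refine Finset.sum_congr rfl fun j _ => ?_
      rw [costMatrix_apply]
      ring
    simp only [e, Finset.sum_add_distrib, ← Finset.mul_sum]
    rw [Finset.sum_comm]
    congr 1
    exact Finset.sum_congr rfl fun k _ => by rw [pow_two, Finset.sum_mul]
  have b1 := (abs_le.1 (abs_sum_quadratic_le hK0 hK fun i (_ : Fin 1) => x i)).1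
  have b2 := (abs_le.1 (abs_sum_quadratic_le hK0 hK
    fun i (q : Fin p × Fin p) => x i * (V i q.1 * V i q.2))).1
  have b3 := (abs_le.1 (abs_sum_quadratic_le hK0 hK V)).2
  have s1 : ∑ i, ∑ _k : Fin 1, x i ^ 2 = (n : ℝ) := by simp [hx]
  have s2 : ∑ i, ∑ q : Fin p × Fin p, (x i * (V i q.1 * V i q.2)) ^ 2 = (n : ℝ) := by
    have : ∀ i, ∑ q : Fin p × Fin p, (x i * (V i q.1 * V i q.2)) ^ 2 = 1 := by
      intro i
      simp only [mul_pow, hx, one_mul]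
      rw [Fintype.sum_prod_type]
      simp only [← Finset.mul_sum, hV, mul_one]
    simp [this]
  have s3 : ∑ i, ∑ k, V i k ^ 2 = (n : ℝ) := by simp [hV]
  rw [s1] at b1
  rw [s2] at b2
  rw [s3] at b3
  rw [hl, hr] at h
  have hg := sum_sq_gram_ge (by omega) hV
  set M := ∑ k, (∑ i, x i * V i k) ^ 2
  set A1 := ∑ i, ∑ j, W i j * ∑ _k : Fin 1, x i * x j
  set A2 := ∑ i, ∑ j, W i j * ∑ q : Fin p × Fin p,
    (x i * (V i q.1 * V i q.2)) * (x j * (V j q.1 * V j q.2))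
  set A3 := ∑ i, ∑ j, W i j * ∑ k, V i k * V j k
  have hn : (0 : ℝ) ≤ n := Nat.cast_nonneg n
  have c1 : -((p - 2) * (σ * (K * n))) ≤ σ * ((p - 2) * A1) := by
    have := mul_le_mul_of_nonneg_left b1 (mul_nonneg hσ (by linarith : (0 : ℝ) ≤ p - 2))
    linarith
  have c2 : -(σ * (K * n)) ≤ σ * A2 := by
    have := mul_le_mul_of_nonneg_left b2 hσ
    linarith
  have c3 : (p - 1) * (σ * A3) ≤ (p - 1) * (σ * (K * n)) :=
    mul_le_mul_of_nonneg_left (mul_le_mul_of_nonneg_left b3 hσ) (by linarith)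
  have c4 : (p - 1) * (σ * (K * n)) ≤ (p - 1) * (n ^ 2 / 8) :=
    mul_le_mul_of_nonneg_left (by nlinarith [mul_le_mul_of_nonneg_right hσK hn]) (by linarith)
  -- `p - 2 + 1/p = (p - 1)² / p`, and `(p - 1)/p ≥ 1/2` for `p ≥ 2`.
  have c5 : (p - 1 : ℝ) * (n ^ 2 / 2) ≤ (p - 2) * n ^ 2 + n ^ 2 / p := by
    have hpp : (0 : ℝ) < p := by linarith
    have : (p - 1 : ℝ) / 2 ≤ (p - 2) + 1 / p := by
      rw [← sub_le_iff_le_add', le_div_iff₀ hpp]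
      nlinarith
    have := mul_le_mul_of_nonneg_right this (sq_nonneg (n : ℝ))
    calc _ = (p - 1 : ℝ) / 2 * n ^ 2 := by ring
      _ ≤ _ := this
      _ = _ := by ring
  have c6 : (p - 1) * (n ^ 2 / 4) ≤ (p - 1) * M := by linarith
  exact le_of_mul_le_mul_left c6 (by linarith)

/-- A unit vector `v` with `l v = α u + e`, where `u` is a unit vector, is close to `u`. -/
lemma sq_mul_sum_sq_sub_le {v u e : Fin p → ℝ} {l α : ℝ} (hv : ∑ k, v k ^ 2 = 1)
    (hu : ∑ k, u k ^ 2 = 1) (hl : 0 ≤ l) (hα : 0 ≤ α) (h : ∀ k, l * v k = α * u k + e k) :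
    α ^ 2 * ∑ k, (v k - u k) ^ 2 ≤ 4 * ∑ k, e k ^ 2 := by
  have h1 : ∑ k, (v k - u k) ^ 2 = 2 - 2 * ∑ k, v k * u k := by
    have : ∀ k, (v k - u k) ^ 2 = v k ^ 2 + u k ^ 2 - 2 * (v k * u k) := fun k => by ring
    simp only [this, Finset.sum_sub_distrib, Finset.sum_add_distrib, hv, hu, ← Finset.mul_sum]
    norm_num
  have h2 : ∑ k, e k ^ 2 = l ^ 2 + α ^ 2 - 2 * l * α * ∑ k, v k * u k := by
    have : ∀ k, e k ^ 2 = l ^ 2 * v k ^ 2 + α ^ 2 * u k ^ 2 - 2 * l * α * (v k * u k) := by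
      intro k
      rw [eq_sub_of_add_eq' (h k).symm]
      ring
    simp only [this, Finset.sum_sub_distrib, Finset.sum_add_distrib, ← Finset.mul_sum, hv, hu,
      mul_one]
  have hc1 : (∑ k, v k * u k) ≤ 1 := by
    have : 0 ≤ ∑ k, (v k - u k) ^ 2 := Finset.sum_nonneg fun _ _ => sq_nonneg _
    linarith
  have hc2 : -1 ≤ ∑ k, v k * u k := by
    have h3 : ∑ k, (v k + u k) ^ 2 = 2 + 2 * ∑ k, v k * u k := by
      have : ∀ k, (v k + u k) ^ 2 = v k ^ 2 + u k ^ 2 + 2 * (v k * u k) := fun k => by ring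
      simp only [this, Finset.sum_add_distrib, hv, hu, ← Finset.mul_sum]
      norm_num
    have : 0 ≤ ∑ k, (v k + u k) ^ 2 := Finset.sum_nonneg fun _ _ => sq_nonneg _
    linarith
  rw [h1, h2]
  generalize ∑ k, v k * u k = c at *
  -- For `c ≤ 0` the cross term only helps, by `l, α ≥ 0`, and `1 - c ≤ 2`. For `c ≥ 0`, minimizing
  -- over `l` leaves `α²(1 - c²)`.
  rcases le_total c 0 with hc | hc
  · nlinarith [mul_nonneg (mul_nonneg hl hα) (neg_nonneg.2 hc), sq_nonneg l,
      mul_nonneg (sq_nonneg α) (by linarith : 0 ≤ 1 + c)]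
  · nlinarith [sq_nonneg (l - α * c), mul_nonneg (sq_nonneg α)
      (mul_nonneg (sub_nonneg.2 hc1) (by linarith : 0 ≤ 1 + 2 * c))]

/-- If the noise is small, a second-order critical point is `x uᵀ` for some unit vector `u`. -/
lemma exists_eq_signal_mul {x : Fin n → ℝ} {σ K c : ℝ} {W : Matrix (Fin n) (Fin n) ℝ}
    {V : Fin n → Fin p → ℝ} (hn : 0 < n) (hp : 2 ≤ p) (hσ : 0 ≤ σ) (hx : ∀ i, x i ^ 2 = 1)
    (hW : ∀ i, W i i = 0) (hK0 : 0 ≤ K)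
    (hK : ∀ b : Fin n → ℝ, ∑ i, (∑ j, W i j * b j) ^ 2 ≤ K ^ 2 * ∑ j, b j ^ 2)
    (hc0 : 0 < c) (hc1 : c ≤ 1) (hσK : σ * K < c / 8 * n)
    (hrow : ∀ i, c * n ≤ n + σ * (x i * ∑ j, W i j * x j))
    (hV : ∀ i, ∑ k, V i k ^ 2 = 1)
    (hfo : ∀ i k, ∑ j, costMatrix x σ W i j * V j k =
      multiplier (costMatrix x σ W) V i * V i k)
    (hso : ∀ U : Fin n → Fin p → ℝ, (∀ i, ∑ k, U i k * V i k = 0) →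
      ∑ i, ∑ k, (∑ j, costMatrix x σ W i j * U j k) * U i k ≤
        ∑ i, multiplier (costMatrix x σ W) V i * ∑ k, U i k ^ 2) :
    ∃ u : Fin p → ℝ, ∑ k, u k ^ 2 = 1 ∧ ∀ i k, V i k = x i * u k := by
  have hn' : (0 : ℝ) < n := by exact_mod_cast hn
  have hσK0 : 0 ≤ σ * K := mul_nonneg hσ hK0
  have hxx : ∀ i, x i * x i = 1 := fun i => by rw [← pow_two, hx]
  have hl := multiplier_nonneg_of_second_order hp
    (fun i => by rw [costMatrix_apply, hW, hxx]; simp) hV hso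
  set l := multiplier (costMatrix x σ W) V
  have hm := sq_correlation_ge hp hσ hx hK0 hK (by nlinarith) hV hso
  set m : Fin p → ℝ := fun k => ∑ i, x i * V i k with hmdef
  set M := √(∑ k, m k ^ 2) with hMdef
  have hM2 : M ^ 2 = ∑ k, m k ^ 2 := Real.sq_sqrt (Finset.sum_nonneg fun _ _ => sq_nonneg _)
  have hMn : n / 2 ≤ M := Real.le_sqrt_of_sq_le (by linarith)
  have hM0 : 0 < M := by linarith
  set u : Fin p → ℝ := fun k => m k / M with hudef
  have hmu : ∀ k, m k = M * u k := fun k => by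
    simp only [hudef]
    field_simp
  have hu : ∑ k, u k ^ 2 = 1 := by
    simp only [hudef, div_pow, ← Finset.sum_div, ← hM2]
    exact div_self (pow_ne_zero 2 hM0.ne')
  have hw : ∀ i, ∑ k, (x i * V i k) ^ 2 = 1 := fun i => by
    simp only [mul_pow, hx, one_mul, hV]
  have hfo' : ∀ i k, l i * (x i * V i k) = m k + x i * (σ * ∑ j, W i j * V j k) := by
    intro i k
    have h1 : ∑ j, costMatrix x σ W i j * V j k = x i * m k + σ * ∑ j, W i j * V j k := by
      simp only [hmdef, Finset.mul_sum]
      rw [← Finset.sum_add_distrib]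
      refine Finset.sum_congr rfl fun j _ => ?_
      rw [costMatrix_apply]
      ring
    have h2 := h1.symm.trans (hfo i k)
    linear_combination (-x i) * h2 + m k * hxx i
  set ρ := ∑ i, ∑ k, (x i * V i k - u k) ^ 2 with hρdef
  have hρ0 : 0 ≤ ρ := Finset.sum_nonneg fun _ _ => Finset.sum_nonneg fun _ _ => sq_nonneg _
  have hρ : ρ = 2 * n - 2 * M := by
    have e1 : ∀ i, ∑ k, (x i * V i k - u k) ^ 2 = 2 - 2 * ∑ k, (x i * V i k) * u k := by
      intro i
      have : ∀ k, (x i * V i k - u k) ^ 2 =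
          (x i * V i k) ^ 2 + u k ^ 2 - 2 * ((x i * V i k) * u k) := fun k => by ring
      simp only [this, Finset.sum_sub_distrib, Finset.sum_add_distrib, hw, hu, ← Finset.mul_sum]
      norm_num
    have e2 : ∑ i, ∑ k, (x i * V i k) * u k = M := by
      rw [Finset.sum_comm]
      simp only [← Finset.sum_mul]
      change ∑ k, m k * u k = M
      have : ∀ k, m k * u k = M * u k ^ 2 := fun k => by rw [hmu k]; ring
      simp only [this, ← Finset.mul_sum, hu, mul_one]
    simp only [hρdef, e1, Finset.sum_sub_distrib, ← Finset.mul_sum, e2]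
    simp
    ring
  have hnoise : ∀ B : Fin n → Fin p → ℝ,
      ∑ i, 4 * ∑ k, (x i * (σ * ∑ j, W i j * B j k)) ^ 2 ≤
        4 * (σ * K) ^ 2 * ∑ i, ∑ k, B i k ^ 2 := by
    intro B
    simp only [mul_pow, hx, one_mul, ← Finset.mul_sum]
    have := mul_le_mul_of_nonneg_left (sum_sq_mul_le hK B) (sq_nonneg σ)
    linarith
  have hclose : M ^ 2 * ρ ≤ 4 * (σ * K) ^ 2 * n := by
    have h1 : ∀ i, M ^ 2 * ∑ k, (x i * V i k - u k) ^ 2 ≤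
        4 * ∑ k, (x i * (σ * ∑ j, W i j * V j k)) ^ 2 := fun i =>
      sq_mul_sum_sq_sub_le (hw i) hu (hl i) hM0.le fun k => by rw [hfo' i k, hmu k]
    have h2 := (Finset.sum_le_sum fun i (_ : i ∈ Finset.univ) => h1 i).trans (hnoise V)
    rw [← Finset.mul_sum] at h2
    simpa [hV] using h2
  have hsq : (σ * K) ^ 2 ≤ (c / 8 * n) ^ 2 := pow_le_pow_left₀ hσK0 hσK.le 2
  -- With `M ≥ n/2`, `hclose` gives `ρ ≤ c²n/4`, and `ρ = 2n - 2M`.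
  have hMc : n - c / 2 * n ≤ M := by
    have h1 : (n / 2 : ℝ) ^ 2 * ρ ≤ M ^ 2 * ρ := by gcongr
    have h2 : (n / 2 : ℝ) ^ 2 * ρ ≤ n ^ 2 * (n * (c ^ 2 / 16)) := by
      nlinarith [mul_le_mul_of_nonneg_right hsq hn'.le]
    have h3 : n ^ 2 * (ρ / 4) ≤ n ^ 2 * (n * (c ^ 2 / 16)) := by linarith
    have h4 := le_of_mul_le_mul_left h3 (by positivity)
    have h5 : c ^ 2 ≤ c := by nlinarith
    nlinarith [mul_le_mul_of_nonneg_left h5 hn'.le]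
  -- Second pass: the noise along `xuᵀ` moves into `α = M + σ x_i (Wx)_i`, so the error is
  -- proportional to `ρ` rather than to `n`.
  have hfinal : (c / 2 * n) ^ 2 * ρ ≤ 4 * (σ * K) ^ 2 * ρ := by
    have h1 : ∀ i, (c / 2 * n) ^ 2 * ∑ k, (x i * V i k - u k) ^ 2 ≤
        4 * ∑ k, (x i * (σ * ∑ j, W i j * (V j k - x j * u k))) ^ 2 := by
      intro i
      have hα : c / 2 * n ≤ M + σ * (x i * ∑ j, W i j * x j) := by linarith [hrow i]
      have hα0 : 0 ≤ c / 2 * n := by positivity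
      refine le_trans ?_ (sq_mul_sum_sq_sub_le (hw i) hu (hl i) (hα0.trans hα) fun k => ?_)
      · gcongr
      · rw [hfo' i k, hmu k]
        simp only [mul_sub, Finset.sum_sub_distrib]
        have : ∑ j, W i j * (x j * u k) = (∑ j, W i j * x j) * u k := by
          simp only [Finset.sum_mul, mul_assoc]
        rw [this]
        ring
    have h2 := (Finset.sum_le_sum fun i (_ : i ∈ Finset.univ) => h1 i).trans
      (hnoise fun j k => V j k - x j * u k)
    rw [← Finset.mul_sum] at h2
    have h3 : ∑ i, ∑ k, (V i k - x i * u k) ^ 2 = ρ := by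
      refine Finset.sum_congr rfl fun i _ => Finset.sum_congr rfl fun k _ => ?_
      linear_combination (u k ^ 2 - V i k ^ 2) * hx i
    rwa [h3] at h2
  have hρz : ρ = 0 := by
    by_contra hne
    have hpos : 0 < ρ := lt_of_le_of_ne hρ0 (Ne.symm hne)
    have := le_of_mul_le_mul_right hfinal hpos
    have hcn : 0 < (c * n) ^ 2 := by positivity
    nlinarith
  refine ⟨u, hu, fun i k => ?_⟩
  have h1 := (Finset.sum_eq_zero_iff_of_nonneg fun i _ =>
    Finset.sum_nonneg fun k _ => sq_nonneg _).1 hρz i (Finset.mem_univ i)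
  have h2 := (Finset.sum_eq_zero_iff_of_nonneg fun k _ => sq_nonneg _).1 h1 k (Finset.mem_univ k)
  have h3 : x i * V i k - u k = 0 := pow_eq_zero_iff two_ne_zero |>.1 h2
  linear_combination x i * h3 - V i k * hxx i

/-- The dual certificate `diag (x ∘ C x) - C` is positive semidefinite. -/
lemma dual_certificate_nonneg {x : Fin n → ℝ} {σ K : ℝ} {W : Matrix (Fin n) (Fin n) ℝ}
    (hn : 0 < n) (hσ : 0 ≤ σ) (hx : ∀ i, x i ^ 2 = 1) (hW : ∀ i j, W i j = W j i) (hK0 : 0 ≤ K)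
    (hK : ∀ b : Fin n → ℝ, ∑ i, (∑ j, W i j * b j) ^ 2 ≤ K ^ 2 * ∑ j, b j ^ 2)
    (hrow : ∀ i, σ * K ≤ n + σ * (x i * ∑ j, W i j * x j)) (y : Fin n → ℝ) :
    ∑ i, (∑ j, costMatrix x σ W i j * y j) * y i ≤
      ∑ i, (x i * ∑ j, costMatrix x σ W i j * x j) * y i ^ 2 := by
  have hn' : (n : ℝ) ≠ 0 := by exact_mod_cast hn.ne'
  have hCx : ∀ i, x i * ∑ j, costMatrix x σ W i j * x j =
      n + σ * (x i * ∑ j, W i j * x j) := by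
    intro i
    have : ∀ j, costMatrix x σ W i j * x j = x i + σ * (W i j * x j) := by
      intro j
      rw [costMatrix_apply]
      linear_combination x i * hx j
    simp only [this, Finset.sum_add_distrib, ← Finset.mul_sum, Finset.sum_const, Finset.card_univ,
      Fintype.card_fin, nsmul_eq_mul]
    linear_combination (n : ℝ) * hx i
  set d : Fin n → ℝ := fun i => n + σ * (x i * ∑ j, W i j * x j) with hd
  simp only [hCx]
  set C := costMatrix x σ W with hCdef
  have hC : ∀ i j, C i j = C j i := fun i j => by
    rw [hCdef, costMatrix_apply, costMatrix_apply, hW i j]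
    ring
  -- The certificate annihilates `x`, so only the part `z` of `y` orthogonal to `x` counts; there
  -- `xxᵀ` vanishes and `d i ≥ σK` dominates the noise.
  set β : ℝ := (∑ j, x j * y j) / n
  set z : Fin n → ℝ := fun i => y i - β * x i with hz
  have hxz : ∑ j, x j * z j = 0 := by
    have : ∀ j, x j * z j = x j * y j - β := by
      intro j
      simp only [hz]
      linear_combination (-β) * hx j
    simp only [this, Finset.sum_sub_distrib, Finset.sum_const, Finset.card_univ,
      Fintype.card_fin, nsmul_eq_mul]
    simp only [β]
    field_simp
    ring
  have hCx' : ∀ i, ∑ j, C i j * x j = d i * x i := by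
    intro i
    simp only [hd, ← hCx]
    linear_combination (-∑ j, C i j * x j) * hx i
  have hy : ∀ i, y i = β * x i + z i := fun i => by simp [hz]
  have hsymm : ∑ i, (∑ j, C i j * z j) * x i = ∑ i, d i * x i * z i := by
    simp only [← hCx', Finset.sum_mul]
    rw [Finset.sum_comm]
    refine Finset.sum_congr rfl fun i _ => Finset.sum_congr rfl fun j _ => ?_
    rw [hC j i]
    ring
  have hCz : ∀ i, ∑ j, C i j * z j = σ * ∑ j, W i j * z j := by
    intro i
    have : ∀ j, C i j * z j = x i * (x j * z j) + σ * (W i j * z j) := fun j => by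
      rw [hCdef, costMatrix_apply]
      ring
    simp only [this, Finset.sum_add_distrib, ← Finset.mul_sum, hxz]
    ring
  have hCy : ∀ i, ∑ j, C i j * y j = β * (d i * x i) + ∑ j, C i j * z j := by
    intro i
    rw [← hCx', Finset.mul_sum, ← Finset.sum_add_distrib]
    refine Finset.sum_congr rfl fun j _ => ?_
    rw [hy j]
    ring
  have hdiff : ∑ i, d i * y i ^ 2 - ∑ i, (∑ j, C i j * y j) * y i =
      ∑ i, d i * z i ^ 2 - σ * ∑ i, z i * ∑ j, W i j * z j := by
    have e : ∀ i, d i * y i ^ 2 - (∑ j, C i j * y j) * y i =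
        d i * z i ^ 2 - σ * (z i * ∑ j, W i j * z j) +
          β * (d i * x i * z i - (∑ j, C i j * z j) * x i) := by
      intro i
      rw [hCy, hy i, hCz]
      ring
    rw [← Finset.sum_sub_distrib]
    simp only [e, Finset.sum_add_distrib, Finset.sum_sub_distrib, ← Finset.mul_sum, hsymm]
    ring
  have hquad := (abs_le.1 (abs_quadratic_le hK0 hK z)).2
  have h1 := mul_le_mul_of_nonneg_left hquad hσ
  have h2 : σ * K * ∑ i, z i ^ 2 ≤ ∑ i, d i * z i ^ 2 := by
    rw [Finset.mul_sum]
    gcongr with i _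
    exact hrow i
  linarith

lemma objective_eq (C : Matrix (Fin n) (Fin n) ℝ) (hC : ∀ i j, C i j = C j i)
    (V : MatSpace n p) :
    objective p C V = -∑ k, ∑ i, (∑ j, C i j * toMat V j k) * toMat V i k := by
  have hCt : C.transpose = C := by
    ext i j
    exact hC j i
  rw [objective_eq_inner, hCt, inner_matSpace, Finset.sum_comm]
  simp only [leftMul_apply, mul_comm (V _)]
  rfl

/-- If the noise has small operator norm and the row sums of
`diag x * C * diag x` are bounded below, second-order critical points are optimal. -/
theorem IsSecondOrderCritical.isOptimal_of_noise_bounds {x : Fin n → ℝ} {σ K c : ℝ}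
    {W : Matrix (Fin n) (Fin n) ℝ} (hn : 0 < n) (hp : 2 ≤ p) (hσ : 0 ≤ σ)
    (hx : ∀ i, x i ^ 2 = 1) (hW : ∀ i j, W i j = W j i) (hW0 : ∀ i, W i i = 0) (hK0 : 0 ≤ K)
    (hK : ∀ b : Fin n → ℝ, ∑ i, (∑ j, W i j * b j) ^ 2 ≤ K ^ 2 * ∑ j, b j ^ 2)
    (hc0 : 0 < c) (hc1 : c ≤ 1) (hσK : σ * K < c / 8 * n)
    (hrow : ∀ i, c * n ≤ n + σ * (x i * ∑ j, W i j * x j))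
    {V : MatSpace n p} (hV : IsSecondOrderCritical (costMatrix x σ W) V) :
    IsOptimal (costMatrix x σ W) V ∧
      toMat V * (toMat V).transpose = Matrix.vecMulVec x x := by
  have hn' : (0 : ℝ) < n := by exact_mod_cast hn
  have hC : ∀ i j, costMatrix x σ W i j = costMatrix x σ W j i := fun i j => by
    rw [costMatrix_apply, costMatrix_apply, hW i j]
    ring
  obtain ⟨h1, h2, h3⟩ := hV.euclidean_conditions hC
  obtain ⟨u, hu, hVu⟩ := exists_eq_signal_mul hn hp hσ hx hW0 hK0 hK hc0 hc1 hσK hrow h1 h2 h3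
  refine ⟨⟨hV.mem_feasible, fun V' hV' => ?_⟩, ?_⟩
  · have hV'1 : ∀ i, ∑ k, toMat V' i k ^ 2 = 1 := by
      intro i
      simpa [Matrix.mul_apply, pow_two] using hV' i
    rw [objective_eq _ hC, objective_eq _ hC, neg_le_neg_iff]
    have hrow' : ∀ i, σ * K ≤ n + σ * (x i * ∑ j, W i j * x j) := fun i => by
      have := hrow i
      have : 0 < c * n := by positivity
      linarith
    -- The certificate is applied to each column of `V'`. Since the rows of `V'` have norm one, the
    -- upper bound is the sum of its diagonal entries, which `V = xuᵀ` attains.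
    refine (Finset.sum_le_sum fun k _ =>
      dual_certificate_nonneg hn hσ hx hW hK0 hK hrow' fun i => toMat V' i k).trans_eq ?_
    rw [Finset.sum_comm, Finset.sum_comm (γ := Fin p)]
    refine Finset.sum_congr rfl fun i _ => ?_
    simp only [hVu]
    rw [← Finset.mul_sum, hV'1, mul_one]
    have : ∀ k, (∑ j, costMatrix x σ W i j * (x j * u k)) * (x i * u k) =
        (x i * ∑ j, costMatrix x σ W i j * x j) * u k ^ 2 := by
      intro k
      simp only [← mul_assoc, ← Finset.sum_mul]
      ring
    simp only [this, ← Finset.mul_sum, hu, mul_one]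
  · ext i j
    rw [Matrix.mul_apply, Matrix.vecMulVec_apply]
    simp only [Matrix.transpose_apply, hVu]
    have : ∀ k, x i * u k * (x j * u k) = x i * x j * u k ^ 2 := fun k => by ring
    simp only [this, ← Finset.mul_sum, hu, mul_one]

end Deterministic

end Z2Sync

/-! ### Gaussian tail bounds for bilinear forms and rows of the noise -/

namespace Z2Sync

open MeasureTheory ProbabilityTheory Real

lemma hasSubgaussianMGF_of_hasLaw_gaussian {Ω : Type*} [MeasurableSpace Ω] {μ : Measure Ω}
    {X : Ω → ℝ} (h : HasLaw X (gaussianReal 0 1) μ) : HasSubgaussianMGF X 1 μ := by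
  have hm : ∀ t, mgf X μ t = exp ((1 : NNReal) * t ^ 2 / 2) := by
    intro t
    rw [mgf_gaussianReal h.map_eq]
    simp
  refine ⟨fun t => ?_, fun t => (hm t).le⟩
  have hμ : NeZero μ := by
    refine ⟨?_⟩
    rintro rfl
    have := hm 0
    simp at this
  -- A non-integrable exponential would have `mgf` zero by convention, so positivity gives
  -- integrability.
  rw [← mgf_pos_iff, hm]
  exact exp_pos _

lemma hasSubgaussianMGF_const_mul_of_hasLaw_gaussian {Ω : Type*} [MeasurableSpace Ω]
    {μ : Measure Ω} {X : Ω → ℝ} (h : HasLaw X (gaussianReal 0 1) μ) (a : ℝ) :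
    HasSubgaussianMGF (fun ω => a * X ω) (a ^ 2).toNNReal μ := by
  have ha : (a ^ 2).toNNReal = NNReal.mk (a ^ 2) (sq_nonneg a) * 1 := by
    rw [Real.toNNReal_of_nonneg (sq_nonneg a), mul_one]
  rw [ha]
  exact (hasSubgaussianMGF_of_hasLaw_gaussian h).const_mul a

/-- Tail bound for linear combinations of independent standard Gaussian variables. -/
lemma measureReal_sum_mul_ge_le {Ω ι : Type*} [Fintype ι] [MeasurableSpace Ω] {μ : Measure Ω}
    {X : ι → Ω → ℝ} (hlaw : ∀ i, HasLaw (X i) (gaussianReal 0 1) μ) (hind : iIndepFun X μ)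
    (a : ι → ℝ) {s t : ℝ} (ha : ∑ i, a i ^ 2 ≤ s) (hs : 0 < s) (ht : 0 ≤ t) :
    μ.real {ω | t ≤ ∑ i, a i * X i ω} ≤ exp (-t ^ 2 / (2 * s)) := by
  have hind' : iIndepFun (fun i ω => a i * X i ω) μ :=
    hind.comp (fun i y => a i * y) fun i => measurable_const_mul (a i)
  have h := HasSubgaussianMGF.sum_of_iIndepFun hind' (s := Finset.univ) fun i _ =>
    hasSubgaussianMGF_const_mul_of_hasLaw_gaussian (hlaw i) (a i)
  have hle : ((∑ i, (a i ^ 2).toNNReal : NNReal) : ℝ) ≤ (s.toNNReal : ℝ) := by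
    rw [NNReal.coe_sum, Real.coe_toNNReal _ hs.le]
    simpa only [Real.coe_toNNReal _ (sq_nonneg _)] using ha
  have h' : HasSubgaussianMGF (fun ω => ∑ i, a i * X i ω) s.toNNReal μ :=
    ⟨h.integrable_exp_mul, fun u => (h.mgf_le u).trans (by gcongr)⟩
  rw [← Real.coe_toNNReal s hs.le]
  exact h'.measure_ge_le ht

lemma sum_pairs_add_swap {n : ℕ} (f : Fin n → Fin n → ℝ) (hf : ∀ i, f i i = 0) :
    ∑ i, ∑ j, f i j =
      ∑ e : {e : Fin n × Fin n // e.1 < e.2}, (f e.1.1 e.1.2 + f e.1.2 e.1.1) := by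
  have hcard : ∀ g : Fin n → Fin n → ℝ, ∑ e : {e : Fin n × Fin n // e.1 < e.2}, g e.1.1 e.1.2 =
      ∑ i, ∑ j, if i < j then g i j else 0 := by
    intro g
    rw [← Fintype.sum_prod_type' (fun i j => if i < j then g i j else 0), ← Finset.sum_filter]
    exact (Finset.sum_subtype _ (by simp) (fun e : Fin n × Fin n => g e.1 e.2)).symm
  rw [Finset.sum_add_distrib, hcard f, hcard fun i j => f j i,
    Finset.sum_comm (f := fun i j => if i < j then f j i else 0), ← Finset.sum_add_distrib]
  refine Finset.sum_congr rfl fun i _ => ?_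
  rw [← Finset.sum_add_distrib]
  refine Finset.sum_congr rfl fun j _ => ?_
  rcases lt_trichotomy i j with h | rfl | h
  · simp [h, h.not_gt]
  · simp [hf]
  · simp [h, h.not_gt]

lemma sum_pairs_le {n : ℕ} (f : Fin n → Fin n → ℝ) (hf : ∀ i, 0 ≤ f i i) :
    ∑ e : {e : Fin n × Fin n // e.1 < e.2}, (f e.1.1 e.1.2 + f e.1.2 e.1.1) ≤
      ∑ i, ∑ j, f i j := by
  have h := sum_pairs_add_swap (fun i j => if i = j then 0 else f i j) (by simp)
  have h' : ∀ e : {e : Fin n × Fin n // e.1 < e.2}, e.1.1 ≠ e.1.2 ∧ e.1.2 ≠ e.1.1 :=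
    fun e => ⟨e.2.ne, e.2.ne'⟩
  simp only [h', if_false] at h
  rw [← h]
  gcongr with i _ j _
  split_ifs with hij
  · exact hij ▸ hf i
  · exact le_rfl

variable {Ω : Type*} [MeasurableSpace Ω] {μ : Measure Ω} {n : ℕ}
  {W : Ω → Matrix (Fin n) (Fin n) ℝ}

lemma IsGaussianNoise.bilin_eq (hW : IsGaussianNoise μ W) (u v : Fin n → ℝ) (ω : Ω) :
    ∑ i, ∑ j, u i * W ω i j * v j = ∑ e : {e : Fin n × Fin n // e.1 < e.2},
      (u e.1.1 * v e.1.2 + u e.1.2 * v e.1.1) * W ω e.1.1 e.1.2 := by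
  rw [sum_pairs_add_swap _ fun i => by simp [hW.diag]]
  refine Finset.sum_congr rfl fun e _ => ?_
  rw [hW.symm ω e.1.2 e.1.1]
  ring

/-- Symmetry of `W` puts `u_i v_j + u_j v_i` on each independent entry, whence the factor `2` in the
variance. -/
lemma IsGaussianNoise.measureReal_bilin_ge_le (hW : IsGaussianNoise μ W) (u v : Fin n → ℝ)
    {s t : ℝ} (hs : 0 < s) (ht : 0 ≤ t) (h : 2 * ((∑ i, u i ^ 2) * ∑ i, v i ^ 2) ≤ s) :
    μ.real {ω | t ≤ ∑ i, ∑ j, u i * W ω i j * v j} ≤ exp (-t ^ 2 / (2 * s)) := by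
  simp only [hW.bilin_eq]
  refine measureReal_sum_mul_ge_le (fun e => hW.law _ _ e.2) hW.indep _ ?_ hs ht
  refine le_trans ?_ h
  rw [Finset.sum_mul_sum, Finset.mul_sum]
  simp only [Finset.mul_sum]
  refine le_trans ?_ (sum_pairs_le (fun i j => 2 * (u i ^ 2 * v j ^ 2)) fun i => by positivity)
  refine Finset.sum_le_sum fun e _ => ?_
  nlinarith [sq_nonneg (u e.1.1 * v e.1.2 - u e.1.2 * v e.1.1)]

/-- Within one row no entry is repeated, so the variance is at most `‖v‖²`, without the factor `2`
of the bilinear bound. The constant `2` in the noise threshold depends on this. -/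
lemma IsGaussianNoise.measureReal_row_ge_le (hW : IsGaussianNoise μ W) (i : Fin n) {c : ℝ}
    (hc : c ^ 2 = 1) (v : Fin n → ℝ) {s t : ℝ} (hs : 0 < s) (ht : 0 ≤ t)
    (h : ∑ j, v j ^ 2 ≤ s) :
    μ.real {ω | t ≤ c * ∑ j, W ω i j * v j} ≤ exp (-t ^ 2 / (2 * s)) := by
  have hrow : ∀ ω, c * ∑ j, W ω i j * v j =
      ∑ a, ∑ j, (if a = i then c else 0) * W ω a j * v j := by
    intro ω
    rw [Finset.sum_eq_single (f := fun a => ∑ j, (if a = i then c else 0) * W ω a j * v j) i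
      (fun a _ ha => by simp [ha]) (by simp)]
    simp [Finset.mul_sum, mul_assoc]
  simp only [hrow, hW.bilin_eq]
  refine measureReal_sum_mul_ge_le (fun e => hW.law _ _ e.2) hW.indep _ ?_ hs ht
  have hsum : ∑ a, ∑ j, (if a = i then v j ^ 2 else 0) = ∑ j, v j ^ 2 := by
    rw [Finset.sum_comm]
    simp
  refine le_trans ?_ (hsum.trans_le h)
  refine le_trans ?_ (sum_pairs_le (fun a j => if a = i then v j ^ 2 else 0) fun a => by
    split_ifs <;> positivity)
  refine Finset.sum_le_sum fun e _ => ?_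
  have hne := e.2.ne
  by_cases h1 : e.1.1 = i
  · have h2 : e.1.2 ≠ i := fun h2 => hne (h1.trans h2.symm)
    simp [h1, h2, mul_pow, hc]
  · by_cases h2 : e.1.2 = i
    · simp [h1, h2, mul_pow, hc]
    · simp [h1, h2]

/-! ### Operator norm of the noise by a net argument -/

/-- A finite set of vectors of norm at most `2` that covers the ball of radius `2` by unit balls. -/
lemma exists_net (E : Type*) [NormedAddCommGroup E] [NormedSpace ℝ E] [FiniteDimensional ℝ E] :
    ∃ N : Finset E, N.card ≤ 5 ^ Module.finrank ℝ E ∧ (∀ u ∈ N, ‖u‖ ≤ 2) ∧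
      ∀ y : E, ‖y‖ ≤ 2 → ∃ u ∈ N, ‖y - u‖ ≤ 1 := by
  classical
  let P : ℕ → Prop := fun m => ∃ N : Finset E, N.card = m ∧ (∀ u ∈ N, ‖u‖ ≤ 2) ∧
    ∀ c ∈ N, ∀ d ∈ N, c ≠ d → 1 ≤ ‖c - d‖
  have hbound : ∀ m, P m → m ≤ 5 ^ Module.finrank ℝ E := by
    rintro m ⟨N, rfl, h1, h2⟩
    exact Besicovitch.card_le_of_separated N h1 h2
  -- A 1-separated set of maximal cardinality covers: any uncovered point could be added to it.
  have hP : P (Nat.findGreatest P (5 ^ Module.finrank ℝ E)) :=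
    Nat.findGreatest_spec (Nat.zero_le _) ⟨∅, by simp⟩
  obtain ⟨N, hN, h1, h2⟩ := hP
  refine ⟨N, hN.trans_le (Nat.findGreatest_le _), h1, fun y hy => ?_⟩
  by_contra! hcon
  have hyN : y ∉ N := fun h => by
    have := hcon y h
    rw [sub_self, norm_zero] at this
    exact absurd this (by norm_num)
  have hlt : P (N.card + 1) := by
    refine ⟨insert y N, Finset.card_insert_of_notMem hyN, ?_, ?_⟩
    · intro u hu
      rcases Finset.mem_insert.1 hu with rfl | hu
      exacts [hy, h1 u hu]
    · intro c hc d hd hcd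
      rcases Finset.mem_insert.1 hc with hc | hc <;> rcases Finset.mem_insert.1 hd with hd | hd
      · exact absurd (hc.trans hd.symm) hcd
      · rw [hc]
        exact (hcon d hd).le
      · rw [norm_sub_rev, hd]
        exact (hcon c hc).le
      · exact h2 c hc d hd hcd
  have := Nat.le_findGreatest (hbound _ hlt) hlt
  omega

/-- Approximating vectors of length `2` with error `1` on each side gives `2‖Tu‖ ≤ K + ‖Tu‖` on the
net, then `2‖T‖ ≤ K + ‖T‖`. -/
lemma opNorm_le_of_net {E : Type*} [NormedAddCommGroup E] [InnerProductSpace ℝ E] {N : Finset E}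
    (hN : ∀ y : E, ‖y‖ ≤ 2 → ∃ u ∈ N, ‖y - u‖ ≤ 1) (T : E →L[ℝ] E) {K : ℝ} (hK : 0 ≤ K)
    (h : ∀ w ∈ N, ∀ u ∈ N, inner ℝ w (T u) ≤ K) : ‖T‖ ≤ K := by
  have key : ∀ y : E, ∃ y', ‖y'‖ ≤ 2 ∧ inner ℝ y' y = 2 * ‖y‖ := by
    intro y
    rcases eq_or_ne y 0 with rfl | hy
    · exact ⟨0, by simp⟩
    · have hy' : ‖y‖ ≠ 0 := norm_ne_zero_iff.2 hy
      refine ⟨(2 * ‖y‖⁻¹) • y, ?_, ?_⟩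
      · rw [norm_smul, Real.norm_of_nonneg (by positivity), mul_assoc, inv_mul_cancel₀ hy', mul_one]
      · rw [real_inner_smul_left, real_inner_self_eq_norm_sq]
        field_simp
  have hTN : ∀ u ∈ N, ‖T u‖ ≤ K := by
    intro u hu
    obtain ⟨y', hy', hin⟩ := key (T u)
    obtain ⟨w, hw, hwy⟩ := hN y' hy'
    have h1 := h w hw u hu
    have h2 : inner ℝ (y' - w) (T u) ≤ ‖T u‖ := (real_inner_le_norm _ _).trans
      (mul_le_of_le_one_left (norm_nonneg _) hwy)
    rw [inner_sub_left, hin] at h2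
    linarith
  have hhalf : ‖T‖ ≤ (K + ‖T‖) / 2 := by
    refine T.opNorm_le_bound (by positivity) fun y => ?_
    rcases eq_or_ne y 0 with rfl | hy
    · simp
    have hy' : 0 < ‖y‖ := norm_pos_iff.2 hy
    obtain ⟨u, hu, hyu⟩ := hN ((2 * ‖y‖⁻¹) • y) (by
      rw [norm_smul, Real.norm_of_nonneg (by positivity), mul_assoc, inv_mul_cancel₀ hy'.ne',
        mul_one])
    have h1 : ‖T ((2 * ‖y‖⁻¹) • y)‖ ≤ K + ‖T‖ := by
      calc ‖T ((2 * ‖y‖⁻¹) • y)‖ = ‖T u + T ((2 * ‖y‖⁻¹) • y - u)‖ := by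
            rw [← map_add, add_sub_cancel]
        _ ≤ ‖T u‖ + ‖T‖ * ‖(2 * ‖y‖⁻¹) • y - u‖ :=
            (norm_add_le _ _).trans (by gcongr; exact T.le_opNorm _)
        _ ≤ K + ‖T‖ * 1 := by gcongr; exact hTN u hu
        _ = K + ‖T‖ := by rw [mul_one]
    rw [map_smul, norm_smul, Real.norm_of_nonneg (by positivity)] at h1
    have h2 := mul_le_mul_of_nonneg_right h1 hy'.le
    have h3 : 2 * ‖y‖⁻¹ * ‖T y‖ * ‖y‖ = 2 * ‖T y‖ := by field_simp
    linarith
  linarith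

/-- With overwhelming probability the operator norm of the noise is at most `20 √n`. -/
lemma IsGaussianNoise.measureReal_opNorm_le (hn : 0 < n) (hW : IsGaussianNoise μ W) :
    μ.real {ω | ¬ ∀ b : Fin n → ℝ,
      ∑ i, (∑ j, W ω i j * b j) ^ 2 ≤ (20 * √n) ^ 2 * ∑ j, b j ^ 2} ≤ exp (-(n : ℝ)) := by
  obtain ⟨N, hcard, hN2, hN⟩ := exists_net (EuclideanSpace ℝ (Fin n))
  have hn' : (0 : ℝ) < n := by exact_mod_cast hn
  have hprob := hW.indep.isProbabilityMeasure
  have hsub : {ω | ¬ ∀ b : Fin n → ℝ,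
      ∑ i, (∑ j, W ω i j * b j) ^ 2 ≤ (20 * √n) ^ 2 * ∑ j, b j ^ 2} ⊆
      ⋃ q ∈ N ×ˢ N, {ω | 20 * √n ≤ ∑ i, ∑ j, q.1 i * W ω i j * q.2 j} := by
    intro ω hω
    by_contra hcon
    simp only [Set.mem_iUnion, Set.mem_ofPred_eq, not_exists, not_le, Finset.mem_product,
      Prod.forall] at hcon
    refine hω fun b => ?_
    have hT := opNorm_le_of_net hN (Matrix.toEuclideanCLM (𝕜 := ℝ) (W ω)) (K := 20 * √n)
      (by positivity) fun w hw u hu => by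
        refine le_trans (le_of_eq ?_) (hcon w u ⟨hw, hu⟩).le
        simp only [PiLp.inner_apply, Matrix.ofLp_toEuclideanCLM, Matrix.mulVec, dotProduct]
        simp [Finset.sum_mul, mul_right_comm, mul_comm (w _)]
    have hb := (Matrix.toEuclideanCLM (𝕜 := ℝ) (W ω)).le_of_opNorm_le hT (WithLp.toLp 2 b)
    have hb2 := pow_le_pow_left₀ (norm_nonneg _) hb 2
    rw [mul_pow, EuclideanSpace.norm_sq_eq, EuclideanSpace.norm_sq_eq] at hb2
    simpa [Matrix.mulVec, dotProduct] using hb2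
  have hsq : ∀ u ∈ N, ∑ i, u i ^ 2 ≤ 4 := by
    intro u hu
    have h := pow_le_pow_left₀ (norm_nonneg _) (hN2 u hu) 2
    rw [EuclideanSpace.norm_sq_eq] at h
    norm_num at h
    exact h
  have h25 : (25 : ℝ) ≤ exp 1 ^ 5 := by
    calc (25 : ℝ) ≤ 2 ^ 5 := by norm_num
      _ ≤ exp 1 ^ 5 := by
        gcongr
        linarith [add_one_le_exp (1 : ℝ)]
  calc _ ≤ μ.real (⋃ q ∈ N ×ˢ N, {ω | 20 * √n ≤ ∑ i, ∑ j, q.1 i * W ω i j * q.2 j}) :=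
        measureReal_mono hsub (measure_ne_top _ _)
    _ ≤ ∑ q ∈ N ×ˢ N, μ.real {ω | 20 * √n ≤ ∑ i, ∑ j, q.1 i * W ω i j * q.2 j} :=
        measureReal_biUnion_finset_le _ _
    -- Net vectors have norm at most `2`, so `32 = 2 · 4 · 4` bounds the variance. The exponent is
    -- `-6.25 n`, which beats the `25 ^ n ≤ e ^ (5n)` pairs by `e ^ (-n)`.
    _ ≤ ∑ q ∈ N ×ˢ N, exp (-(20 * √n) ^ 2 / (2 * 32)) := by
        refine Finset.sum_le_sum fun q hq => ?_
        rw [Finset.mem_product] at hq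
        refine hW.measureReal_bilin_ge_le _ _ (by norm_num) (by positivity) ?_
        have h1 := hsq _ hq.1
        have h2 := hsq _ hq.2
        have h3 := mul_le_mul h1 h2 (Finset.sum_nonneg fun _ _ => sq_nonneg _) (by norm_num)
        linarith
    _ = (N.card : ℝ) ^ 2 * exp (-(20 * √n) ^ 2 / (2 * 32)) := by
        rw [Finset.sum_const, Finset.card_product, nsmul_eq_mul]
        push_cast
        ring
    _ ≤ ((5 : ℝ) ^ n) ^ 2 * exp (-(6 * n)) := by
        rw [finrank_euclideanSpace_fin] at hcard
        gcongr
        · exact_mod_cast hcard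
        · rw [mul_pow, Real.sq_sqrt hn'.le]
          linarith
    _ = 25 ^ n * exp (-(6 * n)) := by
        rw [← pow_mul, mul_comm n 2, pow_mul]
        norm_num
    _ ≤ (exp 1 ^ 5) ^ n * exp (-(6 * n)) := by gcongr
    _ = exp (-(n : ℝ)) := by
        rw [← exp_nat_mul, ← exp_nat_mul, ← exp_add]
        congr 1
        push_cast
        ring

end Z2Sync

/-! ### Row sums, the noise threshold, and the main theorem -/

namespace Z2Sync

open MeasureTheory ProbabilityTheory Real

/-- The rows of the gauged noise are bounded below with high probability. -/
lemma IsGaussianNoise.measureReal_row_sum_le {Ω : Type*} [MeasurableSpace Ω] {μ : Measure Ω}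
    {n : ℕ} {W : Ω → Matrix (Fin n) (Fin n) ℝ} (hn : 1 ≤ n) (hW : IsGaussianNoise μ W)
    {x : Fin n → ℝ} (hx : ∀ i, x i ^ 2 = 1) {a : ℝ} (ha : 0 ≤ a) :
    μ.real {ω | ¬ ∀ i, -√(a * (n * log n)) ≤ x i * ∑ j, W ω i j * x j} ≤
      (n : ℝ) ^ (1 - a / 2) := by
  have hn' : (0 : ℝ) < n := by exact_mod_cast hn
  have hlog : 0 ≤ log n := log_nonneg (by exact_mod_cast hn)
  have hprob := hW.indep.isProbabilityMeasure
  have hsub : {ω | ¬ ∀ i, -√(a * (n * log n)) ≤ x i * ∑ j, W ω i j * x j} ⊆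
      ⋃ i ∈ (Finset.univ : Finset (Fin n)),
        {ω | √(a * (n * log n)) ≤ -x i * ∑ j, W ω i j * x j} := by
    intro ω hω
    obtain ⟨i, hi⟩ := not_forall.1 hω
    simp only [Set.mem_iUnion]
    refine ⟨i, Finset.mem_univ i, ?_⟩
    change √(a * (n * log n)) ≤ -x i * ∑ j, W ω i j * x j
    linarith
  calc _ ≤ μ.real (⋃ i ∈ (Finset.univ : Finset (Fin n)),
        {ω | √(a * (n * log n)) ≤ -x i * ∑ j, W ω i j * x j}) :=
        measureReal_mono hsub (measure_ne_top _ _)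
    _ ≤ ∑ i, μ.real {ω | √(a * (n * log n)) ≤ -x i * ∑ j, W ω i j * x j} :=
        measureReal_biUnion_finset_le _ _
    _ ≤ ∑ _i : Fin n, exp (-√(a * (n * log n)) ^ 2 / (2 * n)) :=
        Finset.sum_le_sum fun i _ => hW.measureReal_row_ge_le i (by rw [neg_sq, hx]) x hn'
          (sqrt_nonneg _) (by simp [hx])
    _ = (n : ℝ) ^ (1 - a / 2) := by
        rw [Finset.sum_const, Finset.card_univ, Fintype.card_fin, nsmul_eq_mul,
          sq_sqrt (by positivity), rpow_sub hn', rpow_one, div_eq_mul_inv (n : ℝ),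
          ← rpow_neg hn'.le, rpow_def_of_pos hn']
        congr 2
        field_simp

/-- The factor `(p - 1)/(p + 1)` is nonpositive for `p ≤ 1`, which contradicts `σ > 0`, and never
exceeds `1`. -/
lemma signal_noise_bounds {p n : ℕ} {ε σ : ℝ} (hσ : 0 < σ)
    (hlt : σ < ((p : ℝ) - 1) / ((p : ℝ) + 1) * √(n / ((2 + ε) * log n))) :
    2 ≤ p ∧ σ < √(n / ((2 + ε) * log n)) := by
  have hp : 2 ≤ p := by
    by_contra hp
    have hp1 : (p : ℝ) ≤ 1 := by exact_mod_cast (by omega : p ≤ 1)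
    have : ((p : ℝ) - 1) / ((p : ℝ) + 1) * √(n / ((2 + ε) * log n)) ≤ 0 :=
      mul_nonpos_of_nonpos_of_nonneg
        (div_nonpos_of_nonpos_of_nonneg (by linarith) (by positivity)) (sqrt_nonneg _)
    linarith
  refine ⟨hp, hlt.trans_le (mul_le_of_le_one_left (sqrt_nonneg _) ?_)⟩
  rw [div_le_one (by positivity)]
  linarith

end Z2Sync

theorem corollary3 (ε : ℝ) (hε : 0 < ε) :
    ∃ N : ℕ, ∀ n : ℕ, N ≤ n → ∀ (p : ℕ) (σ : ℝ) (x : Fin n → ℝ),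
      0 < σ →
      (∀ i, x i = 1 ∨ x i = -1) →
      σ < ((p : ℝ) - 1) / ((p : ℝ) + 1) * Real.sqrt ((n : ℝ) / ((2 + ε) * Real.log (n : ℝ))) →
      ∀ {Ω : Type*} [MeasurableSpace Ω] (μ : MeasureTheory.Measure Ω)
        [MeasureTheory.IsProbabilityMeasure μ] (W : Ω → Matrix (Fin n) (Fin n) ℝ),
        Z2Sync.IsGaussianNoise μ W →
        1 - (n : ℝ) ^ (-(ε / 4)) - 4 * Real.exp (-(n : ℝ)) ≤
          μ.real {ω | ∀ V : Z2Sync.MatSpace n p,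
            Z2Sync.IsSecondOrderCritical (Z2Sync.costMatrix x σ (W ω)) V →
              Z2Sync.IsOptimal (Z2Sync.costMatrix x σ (W ω)) V ∧
              Z2Sync.toMat V * (Z2Sync.toMat V).transpose = Matrix.vecMulVec x x} := by
  -- Any coefficient from `1/2` up to but excluding `1` could replace `3/4`: at least `1/2` makes
  -- the row failure probability at most `n ^ (-ε/4)`, below `1` gives `r < 1`, leaving the margin
  -- `c = 1 - r`.
  set r := √((2 + 3 / 4 * ε) / (2 + ε)) with hr
  have hr0 : 0 ≤ r := Real.sqrt_nonneg _
  have hr1 : r < 1 := by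
    rw [hr, Real.sqrt_lt' one_pos, div_lt_iff₀ (by linarith)]
    linarith
  -- `160 = 20 · 8`, from `K = 20√n` and the requirement `σK < (1 - r) n / 8`.
  obtain ⟨N, hN⟩ := Filter.eventually_atTop.1
    ((Real.tendsto_log_atTop.comp tendsto_natCast_atTop_atTop).eventually_gt_atTop
      ((160 / (1 - r)) ^ 2))
  refine ⟨max N 2, fun n hnN p σ x hσ hx hlt Ω _ μ _ W hW => ?_⟩
  have hn : 1 < n := lt_of_lt_of_le (by norm_num) ((le_max_right N 2).trans hnN)
  have hn' : (0 : ℝ) < n := by positivity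
  have hn1 : (1 : ℝ) < n := by exact_mod_cast hn
  have hlogN : (160 / (1 - r)) ^ 2 < Real.log n := hN n ((le_max_left N 2).trans hnN)
  have hlog : 0 < Real.log n := Real.log_pos hn1
  obtain ⟨hp, hσ'⟩ := Z2Sync.signal_noise_bounds hσ hlt
  have hx2 : ∀ i, x i ^ 2 = 1 := fun i => by rcases hx i with h | h <;> simp [h]
  set t := √((2 + 3 / 4 * ε) * (n * Real.log n)) with ht
  have hσt : σ * t ≤ r * n := by
    calc σ * t ≤ √(n / ((2 + ε) * Real.log n)) * t := by gcongr
      _ = √((2 + 3 / 4 * ε) / (2 + ε) * (n : ℝ) ^ 2) := by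
        rw [ht, ← Real.sqrt_mul (by positivity)]
        congr 1
        field_simp
      _ = r * n := by rw [Real.sqrt_mul (by positivity), Real.sqrt_sq hn'.le]
  have hσK : σ * (20 * √n) < (1 - r) / 8 * n := by
    have h1 : 160 / (1 - r) < √(Real.log n) := Real.lt_sqrt_of_sq_lt hlogN
    have h2 : √(n / ((2 + ε) * Real.log n)) * √n ≤ n / √(Real.log n) := by
      rw [← Real.sqrt_mul (by positivity)]
      refine Real.sqrt_le_iff.2 ⟨by positivity, ?_⟩
      rw [div_pow, Real.sq_sqrt hlog.le, div_mul_eq_mul_div, ← pow_two]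
      gcongr
      nlinarith
    have h3 : n / √(Real.log n) < (1 - r) / 160 * n := by
      rw [div_lt_iff₀ (by positivity)]
      rw [div_lt_iff₀ (by linarith)] at h1
      nlinarith
    have h4 : σ * √n ≤ √(n / ((2 + ε) * Real.log n)) * √n := by gcongr
    linarith
  set good := {ω | ∀ V : Z2Sync.MatSpace n p,
    Z2Sync.IsSecondOrderCritical (Z2Sync.costMatrix x σ (W ω)) V →
      Z2Sync.IsOptimal (Z2Sync.costMatrix x σ (W ω)) V ∧
      Z2Sync.toMat V * (Z2Sync.toMat V).transpose = Matrix.vecMulVec x x} with hgood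
  set B1 := {ω | ¬ ∀ b : Fin n → ℝ,
    ∑ i, (∑ j, W ω i j * b j) ^ 2 ≤ (20 * √n) ^ 2 * ∑ j, b j ^ 2} with hB1
  set B2 := {ω | ¬ ∀ i, -t ≤ x i * ∑ j, W ω i j * x j} with hB2
  have hcover : (Set.univ : Set Ω) ⊆ good ∪ (B1 ∪ B2) := by
    intro ω _
    by_cases h1 : ω ∈ B1
    · exact Or.inr (Or.inl h1)
    by_cases h2 : ω ∈ B2
    · exact Or.inr (Or.inr h2)
    have h1' := not_not.1 h1
    have h2' := not_not.1 h2
    refine Or.inl fun V hV => Z2Sync.IsSecondOrderCritical.isOptimal_of_noise_bounds (by omega) hp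
      hσ.le hx2 (hW.symm ω) (hW.diag ω) (by positivity) h1' (c := 1 - r) (by linarith) (by linarith)
      hσK (fun i => ?_) hV
    have := mul_le_mul_of_nonneg_left (h2' i) hσ.le
    linarith
  have hb1 : μ.real B1 ≤ Real.exp (-(n : ℝ)) := hW.measureReal_opNorm_le (by omega)
  have hb2 : μ.real B2 ≤ (n : ℝ) ^ (-(ε / 4)) := by
    refine (hW.measureReal_row_sum_le hn.le hx2 (by positivity)).trans
      (Real.rpow_le_rpow_of_exponent_le hn1.le ?_)
    linarith
  -- Subadditivity over a cover of the whole space needs no measurability of `good`.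
  have htot : (1 : ℝ) ≤ μ.real good + (μ.real B1 + μ.real B2) := by
    calc (1 : ℝ) = μ.real Set.univ := by simp
      _ ≤ μ.real (good ∪ (B1 ∪ B2)) :=
        MeasureTheory.measureReal_mono hcover (MeasureTheory.measure_ne_top _ _)
      _ ≤ μ.real good + μ.real (B1 ∪ B2) := MeasureTheory.measureReal_union_le _ _
      _ ≤ _ := by gcongr; exact MeasureTheory.measureReal_union_le _ _
  have := Real.exp_pos (-(n : ℝ))
  linarith
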